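/- Write $\Delta(x,y)=|\mathrm{Arg}\,e^{\mathrm{i}(x-y)}|\in[0,\pi]$ for the wrap-around distance, and for nodes $x_1,\dots,x_s\in(-\pi,\pi]$ let $V_N(x)\in\mathbb{C}^{(N+1)\times s}$ be the Vandermonde matrix with entries $(V_N(x))_{k,\ell}=e^{\mathrm{i}k x_\ell}$, $0\le k\le N$, $1\le \ell\le s$. Suppose that $s$ pairwise distinct nodes $x_1,\dots,x_s\in(-\pi,\pi]$ form an $((h^{(j)},\tau^{(j)},s^{(j)})_{j=1}^M,\theta)$-clustered configuration: $\{x_1,\dots,x_s\}$ is the disjoint union of nonempty sets $\mathcal{C}^{(1)},\dots,\mathcal{C}^{(M)}$ such that $\mathcal{C}^{(j)}$ has $s^{(j)}$ elements, $\tau^{(j)}>0$, $\tau^{(j)}h^{(j)}\le\Delta(y,z)\le h^{(j)}$ for all distinct $y,z\in\mathcal{C}^{(j)}$, and $\Delta(y,z)\ge\theta>0$ for all $y\in\mathcal{C}^{(j)}$ and all nodes $z\notin\mathcal{C}^{(j)}$. Let $h=\max_{j}h^{(j)}$. **Theorem 2.5.** There are positive constants $C_1,C_2$ depending only on $(s^{(1)},\dots,s^{(M)})$,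 and for each $j$ a positive constant $C(s^{(j)},\tau^{(j)})$ depending only on $s^{(j)}$ and $\tau^{(j)}$, such that the following holds for every such configuration and every integer $N>s$ with $N\ge C_1/\theta$ and $Nh\le C_2$. Let $a_0\in\mathbb{C}^s$ be arbitrary, $b_0=V_N(x)a_0$, and $b\in\mathbb{C}^{N+1}$. Then the least squares problem $\min_{a\in\mathbb{C}^s}\|V_N(x)a-b\|_2$ has a unique solution $a=a(x,b)$, and for every $j\in\{1,\dots,M\}$ and every $\ell$ with $x_\ell\in\mathcal{C}^{(j)}$, $$\bigl|(a(x,b)-a_0)_\ell\bigr|\le C(s^{(j)},\tau^{(j)})\; s\,\Bigl(\frac{1}{Nh^{(j)}}\Bigr)^{s^{(j)}-1}\|b-b_0\|_\infty ,$$ where for $s^{(j)}=1$ the factor $(1/(Nh^{(j)}))^{0}$ is read as $1$. -/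

import Mathlib

noncomputable section

/-- The wrap-around distance `Δ(x, y) = |Arg exp(i (x - y))| ∈ [0, π]` (`Complex.arg` is the
principal value, in `(-π, π]`). -/
def wrapDist (x y : ℝ) : ℝ :=
  |Complex.arg (Complex.exp (Complex.I * ((x : ℂ) - (y : ℂ))))|

/-- The finite node set `X ⊆ (-π, π]` forms an `(h, τ, m)`-cluster: it has `m` elements and any two
distinct elements have wrap-around distance between `τ h` and `h`, where `τ > 0`. -/
structure IsUniformCluster (h τ : ℝ) (m : ℕ) (X : Finset ℝ) : Prop where
  subset_Ioc : ∀ x ∈ X, x ∈ Set.Ioc (-Real.pi) Real.pi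
  card_eq : X.card = m
  tau_pos : 0 < τ
  le_dist : ∀ x ∈ X, ∀ y ∈ X, x ≠ y → τ * h ≤ wrapDist x y
  dist_le : ∀ x ∈ X, ∀ y ∈ X, x ≠ y → wrapDist x y ≤ h

/-- The node set `{x 0, …, x (s - 1)}` (listed without repetition) forms an
`((h j, τ j, m j)_j, θ)`-clustered configuration, the clusters being the (nonempty) sets `c j`,
`j : Fin M`, of a partition of the node set. -/
structure IsClusteredConfiguration {s M : ℕ} (h τ : Fin M → ℝ) (m : Fin M → ℕ) (θ : ℝ)
    (x : Fin s → ℝ) (c : Fin M → Finset ℝ) : Prop where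
  injective : Function.Injective x
  nonempty : ∀ j, (c j).Nonempty
  disjoint : ∀ j k, j ≠ k → Disjoint (c j) (c k)
  cover : (⋃ j, (c j : Set ℝ)) = Set.range x
  cluster : ∀ j, IsUniformCluster (h j) (τ j) (m j) (c j)
  theta_pos : 0 < θ
  separated : ∀ j, ∀ y ∈ c j, ∀ z ∈ Set.range x, z ∉ c j → θ ≤ wrapDist y z

/-- The indices of the nodes that belong to the cluster `c j`. -/
def clusterIndexSet {s M : ℕ} (x : Fin s → ℝ) (c : Fin M → Finset ℝ) (j : Fin M) : Set (Fin s) :=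
  {l | x l ∈ c j}

/-- The `(N + 1) × s` Vandermonde matrix with nodes `exp(i x_l)` on the unit circle: its `(k, l)`
entry is `exp(i k x_l)`, `0 ≤ k ≤ N`. -/
def vandermondeMatrix (N : ℕ) {s : ℕ} (x : Fin s → ℝ) : Matrix (Fin (N + 1)) (Fin s) ℂ :=
  Matrix.of fun k l => Complex.exp (Complex.I * ((k : ℕ) : ℂ) * (x l : ℂ))

/-- `a` minimizes the Euclidean norm `‖V_N(x) a - b‖₂` over `ℂˢ`. -/
def IsLeastSquaresSolution {N s : ℕ} (x : Fin s → ℝ) (b : Fin (N + 1) → ℂ) (a : Fin s → ℂ) :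
    Prop :=
  IsMinOn (fun a' : Fin s → ℂ =>
    ‖WithLp.toLp 2 ((vandermondeMatrix N x).mulVec a' - b)‖) Set.univ a

end

open Polynomial

/-! The proof is by duality. If a polynomial `P` of degree at most `N` is one at a node and zero at
all others, pairing its coefficients with `V d` returns the entry of `d` there, so Cauchy-Schwarz
bounds this entry by the coefficient norm of `P` times `‖V d‖₂`. For `d = a - a₀`, minimality gives
`‖V d‖₂ ≤ 2 ‖b - b₀‖₂`, which costs `√(N + 1)` in the sup norm. Hence `P` must have coefficient norm
of order `N^(-1/2)` times the cluster loss `(1 / (N h j))^(m j - 1)`.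

`exists_dual_polynomial` builds `P` as a product: a normalized geometric sum of length `D ~ N / (2
m)` with coefficient norm `D^(-1/2)`; for each other node of the cluster, a binomial in `X ^ D` of
size `π / (D τ h)` on the circle; for each node outside, a Fejér-type factor whose sup norm is so
close to one that all of them together cost at most 2. By Parseval (`sum_sq_norm_coeff_mul_le`) only
the sup norms of the last two kinds matter. Applied to `V d = 0`, the same bound gives injectivity,
hence uniqueness. -/

/-! ### Coefficient norms and geometric sums -/

/-- Multiplying a polynomial by one that is bounded by `B` on the unit circle multiplies the
`ℓ²` norm of the coefficients by at most `B`. -/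
theorem sum_sq_norm_coeff_mul_le (P Q : ℂ[X]) {B : ℝ}
    (hQ : ∀ z : ℂ, ‖z‖ = 1 → ‖Q.eval z‖ ≤ B) :
    ∑ i ∈ (P * Q).support, ‖(P * Q).coeff i‖ ^ 2 ≤ B ^ 2 * ∑ i ∈ P.support, ‖P.coeff i‖ ^ 2 := by
  -- Parseval turns both coefficient sums into circle averages, which compare pointwise.
  rw [sum_sq_norm_coeff_eq_circleAverage, sum_sq_norm_coeff_eq_circleAverage,
    ← smul_eq_mul (B ^ 2), ← Real.circleAverage_fun_smul]
  apply Real.circleAverage_mono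
  · exact ContinuousOn.circleIntegrable' (by fun_prop)
  · exact ContinuousOn.circleIntegrable' (by fun_prop)
  · intro z hz
    have hz' : ‖z‖ = 1 := by simpa using hz
    rw [eval_mul, norm_mul, mul_pow, smul_eq_mul, mul_comm]
    gcongr
    exact hQ z hz'

/-- The geometric polynomial `∑_{k < n} (u X)^k`. -/
noncomputable def geomPoly (u : ℂ) (n : ℕ) : ℂ[X] := ∑ k ∈ Finset.range n, C (u ^ k) * X ^ k

theorem eval_geomPoly (u : ℂ) (n : ℕ) (z : ℂ) :
    (geomPoly u n).eval z = ∑ k ∈ Finset.range n, (u * z) ^ k := by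
  simp [geomPoly, eval_finsetSum, mul_pow]

theorem coeff_geomPoly (u : ℂ) (n k : ℕ) :
    (geomPoly u n).coeff k = if k < n then u ^ k else 0 := by
  simp only [geomPoly, finsetSum_coeff, coeff_C_mul_X_pow]
  simp

theorem natDegree_geomPoly_le (u : ℂ) (n : ℕ) : (geomPoly u n).natDegree ≤ n - 1 := by
  rw [natDegree_le_iff_coeff_eq_zero]
  intro k hk
  rw [coeff_geomPoly, if_neg (by omega)]

theorem sum_sq_norm_coeff_geomPoly {u : ℂ} (hu : ‖u‖ = 1) (n : ℕ) :
    ∑ i ∈ (geomPoly u n).support, ‖(geomPoly u n).coeff i‖ ^ 2 = n := by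
  have hs : (geomPoly u n).support ⊆ Finset.range n := by
    intro k hk
    by_contra h
    rw [mem_support_iff, coeff_geomPoly, if_neg (by simpa using h)] at hk
    exact hk rfl
  rw [Finset.sum_subset hs (fun i _ hi => by rw [notMem_support_iff.1 hi]; simp)]
  rw [Finset.sum_congr rfl (g := fun _ => (1 : ℝ))]
  · simp
  · intro k hk
    rw [coeff_geomPoly, if_pos (by simpa using hk), norm_pow, hu]
    simp

theorem norm_geom_sum_mul_le {w : ℂ} (hw : ‖w‖ = 1) (n : ℕ) :
    ‖∑ k ∈ Finset.range n, w ^ k‖ * ‖w - 1‖ ≤ 2 := by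
  rw [← norm_mul, geom_sum_mul]
  calc ‖w ^ n - 1‖ ≤ ‖w ^ n‖ + ‖(1 : ℂ)‖ := norm_sub_le _ _
    _ = 2 := by rw [norm_pow, hw]; norm_num

theorem norm_geom_sum_le {w : ℂ} (hw : ‖w‖ = 1) (n : ℕ) :
    ‖∑ k ∈ Finset.range n, w ^ k‖ ≤ n := by
  refine (norm_sum_le _ _).trans ?_
  simp [hw]

/-- On the unit circle, conjugating the sum and multiplying by `w ^ n` only reverses its terms, so
the sum `S` satisfies `S = w ^ n * conj S`. -/
theorem geom_sum_sq_eq {w : ℂ} (hw : ‖w‖ = 1) (n : ℕ) :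
    (∑ k ∈ Finset.range (n + 1), w ^ k) ^ 2 =
      w ^ n * ((‖∑ k ∈ Finset.range (n + 1), w ^ k‖ ^ 2 : ℝ) : ℂ) := by
  have hc : w ^ n * (starRingEnd ℂ) (∑ k ∈ Finset.range (n + 1), w ^ k) =
      ∑ k ∈ Finset.range (n + 1), w ^ k := by
    rw [map_sum, Finset.mul_sum, ← Finset.sum_range_reflect]
    refine Finset.sum_congr rfl fun k hk => ?_
    have hk' : k ≤ n := by simpa [Nat.lt_succ_iff] using hk
    have h1 : w * (starRingEnd ℂ) w = 1 := by
      rw [Complex.mul_conj, Complex.normSq_eq_norm_sq, hw]; simp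
    obtain ⟨r, rfl⟩ := Nat.exists_eq_add_of_le hk'
    have h2 : k + r + 1 - 1 - k = r := by omega
    rw [map_pow, h2, pow_add, mul_assoc, ← mul_pow, h1, one_pow, mul_one]
  rw [Complex.ofReal_pow, ← Complex.mul_conj', sq]
  nth_rewrite 1 [← hc]
  ring

/-- The Fejér-type factor `w ^ n - S(w)² / (n + 1)²` is real up to a unimodular factor. -/
theorem norm_pow_sub_geom_sum_sq {w : ℂ} (hw : ‖w‖ = 1) (n : ℕ) :
    ‖w ^ n - ((n + 1 : ℂ) ^ 2)⁻¹ * (∑ k ∈ Finset.range (n + 1), w ^ k) ^ 2‖ =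
      1 - (‖∑ k ∈ Finset.range (n + 1), w ^ k‖ / (n + 1)) ^ 2 := by
  have hle := norm_geom_sum_le hw (n + 1)
  rw [geom_sum_sq_eq hw]
  set r := ‖∑ k ∈ Finset.range (n + 1), w ^ k‖
  have h0 : 0 ≤ r := norm_nonneg _
  have : w ^ n - ((n + 1 : ℂ) ^ 2)⁻¹ * (w ^ n * ((r ^ 2 : ℝ) : ℂ)) =
      w ^ n * ((1 - (r / (n + 1)) ^ 2 : ℝ) : ℂ) := by
    push_cast
    rw [div_pow]
    ring
  rw [this, norm_mul, norm_pow, hw, one_pow, one_mul, Complex.norm_real, Real.norm_eq_abs,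
    abs_of_nonneg]
  have : r / (n + 1) ≤ 1 := by
    rw [div_le_one (by positivity)]; exact_mod_cast hle
  have h1 : 0 ≤ r / (n + 1) := by positivity
  nlinarith

/-! ### Interpolation factors -/

/-- An interpolation factor of degree `D`, suited to nearby nodes. -/
theorem exists_near_factor {z₀ z₁ : ℂ} (h₁ : ‖z₁‖ = 1) (D : ℕ) {K : ℝ}
    (hne : (z₁⁻¹ * z₀) ^ D - 1 ≠ 0) (hK : 2 ≤ K * ‖(z₁⁻¹ * z₀) ^ D - 1‖) :
    ∃ Q : ℂ[X], Q.natDegree ≤ D ∧ Q.eval z₀ = 1 ∧ Q.eval z₁ = 0 ∧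
      ∀ z : ℂ, ‖z‖ = 1 → ‖Q.eval z‖ ≤ K := by
  have hz1 : z₁ ≠ 0 := by rintro rfl; simp at h₁
  have hev : ∀ z, (C (((z₁⁻¹ * z₀) ^ D - 1)⁻¹) * (C (z₁⁻¹ ^ D) * X ^ D - 1)).eval z =
      ((z₁⁻¹ * z₀) ^ D - 1)⁻¹ * ((z₁⁻¹ * z) ^ D - 1) := by
    intro z; simp [mul_pow]
  refine ⟨C (((z₁⁻¹ * z₀) ^ D - 1)⁻¹) * (C (z₁⁻¹ ^ D) * X ^ D - 1), ?_, ?_, ?_, ?_⟩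
  · compute_degree
  · rw [hev, inv_mul_cancel₀ hne]
  · rw [hev, inv_mul_cancel₀ hz1]; simp
  · intro z hz
    rw [hev, norm_mul, norm_inv, inv_mul_le_iff₀ (norm_pos_iff.2 hne), mul_comm _ K]
    refine le_trans ?_ hK
    calc ‖(z₁⁻¹ * z) ^ D - 1‖ ≤ ‖(z₁⁻¹ * z) ^ D‖ + ‖(1 : ℂ)‖ := norm_sub_le _ _
      _ = 2 := by rw [norm_pow, norm_mul, norm_inv, h₁, hz]; norm_num

/-- An interpolation factor of degree `2 E`, suited to well separated nodes. -/
theorem exists_far_factor {z₀ z₁ : ℂ} (h₀ : ‖z₀‖ = 1) (h₁ : ‖z₁‖ = 1) (E : ℕ) {δ : ℝ}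
    (hδ : δ < 1) (h : (2 / ((E + 1) * ‖z₁⁻¹ * z₀ - 1‖)) ^ 2 ≤ δ) (hne : z₁⁻¹ * z₀ - 1 ≠ 0) :
    ∃ Q : ℂ[X], Q.natDegree ≤ 2 * E ∧ Q.eval z₀ = 1 ∧ Q.eval z₁ = 0 ∧
      ∀ z : ℂ, ‖z‖ = 1 → ‖Q.eval z‖ ≤ (1 - δ)⁻¹ := by
  have hz1 : z₁ ≠ 0 := by rintro rfl; simp at h₁
  have hu : ∀ z : ℂ, ‖z‖ = 1 → ‖z₁⁻¹ * z‖ = 1 := by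
    intro z hz; rw [norm_mul, norm_inv, h₁, hz]; norm_num
  -- On the circle `|R| = 1 - (|S| / (E + 1))²`: this vanishes at `z₁`, never exceeds one, and is
  -- near one where the geometric sum is small.
  set R : ℂ[X] := C (z₁⁻¹ ^ E) * X ^ E - C ((E + 1 : ℂ) ^ 2)⁻¹ * geomPoly z₁⁻¹ (E + 1) ^ 2
    with hR
  have hev : ∀ z, R.eval z = (z₁⁻¹ * z) ^ E -
      ((E + 1 : ℂ) ^ 2)⁻¹ * (∑ k ∈ Finset.range (E + 1), (z₁⁻¹ * z) ^ k) ^ 2 := by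
    intro z
    simp only [hR, eval_sub, eval_mul, eval_C, eval_pow, eval_X, eval_geomPoly, mul_pow]
  have hnorm : ∀ z : ℂ, ‖z‖ = 1 → ‖R.eval z‖ ≤ 1 := by
    intro z hz
    rw [hev, norm_pow_sub_geom_sum_sq (hu z hz)]
    linarith [sq_nonneg (‖∑ k ∈ Finset.range (E + 1), (z₁⁻¹ * z) ^ k‖ / (E + 1))]
  have hlow : 1 - δ ≤ ‖R.eval z₀‖ := by
    rw [hev, norm_pow_sub_geom_sum_sq (hu z₀ h₀)]
    have hp : 0 < ‖z₁⁻¹ * z₀ - 1‖ := norm_pos_iff.2 hne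
    have : ‖∑ k ∈ Finset.range (E + 1), (z₁⁻¹ * z₀) ^ k‖ / (E + 1) ≤
        2 / ((E + 1) * ‖z₁⁻¹ * z₀ - 1‖) := by
      rw [div_le_div_iff₀ (by positivity) (by positivity)]
      nlinarith [norm_geom_sum_mul_le (hu z₀ h₀) (E + 1), (Nat.cast_nonneg E : (0 : ℝ) ≤ E)]
    have := pow_le_pow_left₀ (by positivity) this 2
    linarith
  have hpos : 0 < ‖R.eval z₀‖ := by linarith
  refine ⟨C (R.eval z₀)⁻¹ * R, ?_, ?_, ?_, ?_⟩
  · refine (natDegree_C_mul_le _ _).trans ?_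
    rw [hR]
    refine (natDegree_sub_le _ _).trans (max_le ?_ ?_)
    · refine (natDegree_C_mul_X_pow_le _ _).trans (by omega)
    · refine (natDegree_C_mul_le _ _).trans ((natDegree_pow_le).trans ?_)
      have := natDegree_geomPoly_le z₁⁻¹ (E + 1)
      simp only [Nat.add_sub_cancel] at this
      omega
  · rw [eval_mul, eval_C, inv_mul_cancel₀ (norm_pos_iff.1 hpos)]
  · rw [eval_mul, hev z₁, inv_mul_cancel₀ hz1]
    have : (E + 1 : ℂ) ≠ 0 := by exact_mod_cast Nat.succ_ne_zero E
    simp [this]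
  · intro z hz
    rw [eval_mul, eval_C, norm_mul, norm_inv]
    calc ‖R.eval z₀‖⁻¹ * ‖R.eval z‖ ≤ (1 - δ)⁻¹ * 1 := by
          gcongr
          exact hnorm z hz
      _ = _ := mul_one _

theorem exists_prod_factor {ι : Type*} (T : Finset ι) (e : ι → ℂ) (z₀ : ℂ) (d : ℕ) (K : ℝ)
    (H : ∀ t ∈ T, ∃ Q : ℂ[X], Q.natDegree ≤ d ∧ Q.eval z₀ = 1 ∧ Q.eval (e t) = 0 ∧
      ∀ z : ℂ, ‖z‖ = 1 → ‖Q.eval z‖ ≤ K) :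
    ∃ Q : ℂ[X], Q.natDegree ≤ T.card * d ∧ Q.eval z₀ = 1 ∧ (∀ t ∈ T, Q.eval (e t) = 0) ∧
      ∀ z : ℂ, ‖z‖ = 1 → ‖Q.eval z‖ ≤ K ^ T.card := by
  choose! Q h1 h2 h3 h4 using H
  refine ⟨∏ t ∈ T, Q t, ?_, ?_, ?_, ?_⟩
  · refine (natDegree_prod_le _ _).trans ?_
    simpa using Finset.sum_le_card_nsmul T _ d h1
  · rw [eval_prod]
    exact Finset.prod_eq_one h2
  · intro t ht
    rw [eval_prod]
    exact Finset.prod_eq_zero ht (h3 t ht)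
  · intro z hz
    rw [eval_prod, norm_prod]
    simpa using Finset.prod_le_prod (fun t _ => norm_nonneg _) (fun t ht => h4 t ht z hz)

/-! ### Chords and wrap-around distance -/

/-- The point `exp (i x)` of the unit circle. -/
noncomputable def circlePoint (x : ℝ) : ℂ := Complex.exp (Complex.I * x)

theorem norm_circlePoint (x : ℝ) : ‖circlePoint x‖ = 1 := by
  rw [circlePoint, mul_comm, Complex.norm_exp_ofReal_mul_I]

theorem wrapDist_le_pi (x y : ℝ) : wrapDist x y ≤ Real.pi := Complex.abs_arg_le_pi _

theorem circlePoint_inv_mul (x y : ℝ) : (circlePoint y)⁻¹ * circlePoint x =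
    Complex.exp (Complex.I * ((x : ℂ) - y)) := by
  rw [circlePoint, circlePoint, ← Complex.exp_neg, ← Complex.exp_add]
  congr 1; ring

/-- The chord of an angle `φ` is `2 |sin (φ / 2)|`; Jordan's inequality applies because `hD` keeps
the half angle within `π / 2`. -/
theorem norm_circlePoint_inv_mul_pow_sub_one_ge (x y : ℝ) (D : ℕ)
    (hD : D * wrapDist x y ≤ Real.pi) :
    2 / Real.pi * (D * wrapDist x y) ≤ ‖((circlePoint y)⁻¹ * circlePoint x) ^ D - 1‖ := by
  set w := (circlePoint y)⁻¹ * circlePoint x with hw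
  have hn : ‖w‖ = 1 := by rw [hw, norm_mul, norm_inv, norm_circlePoint, norm_circlePoint]; simp
  have ht : wrapDist x y = |w.arg| := by rw [hw, circlePoint_inv_mul]; rfl
  have hexp : w ^ D = Complex.exp (Complex.I * ((D * w.arg : ℝ) : ℂ)) := by
    conv_lhs => rw [← Complex.norm_mul_exp_arg_mul_I w, hn]
    rw [Complex.ofReal_one, one_mul, ← Complex.exp_nat_mul]
    congr 1; push_cast; ring
  have habs : |D * w.arg| = D * wrapDist x y := by rw [abs_mul, ht, Nat.abs_cast]
  rw [hexp, Complex.norm_exp_I_mul_ofReal_sub_one, Real.norm_eq_abs, abs_mul,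
    ← habs]
  have h := Real.mul_le_sin (x := |D * w.arg| / 2) (by positivity) (by rw [habs]; linarith)
  have h2 : Real.sin (|D * w.arg| / 2) ≤ |Real.sin (D * w.arg / 2)| := by
    rcases abs_cases (D * w.arg) with ⟨h, -⟩ | ⟨h, -⟩
    · rw [h]; exact le_abs_self _
    · rw [h, neg_div, Real.sin_neg]; exact neg_le_abs _
  rw [abs_two]
  linarith

theorem wrapDist_pos {x y : ℝ} (hx : x ∈ Set.Ioc (-Real.pi) Real.pi)
    (hy : y ∈ Set.Ioc (-Real.pi) Real.pi) (h : x ≠ y) : 0 < wrapDist x y := by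
  have hp := Real.pi_pos
  rw [wrapDist, abs_pos]
  intro h0
  have h1 : Complex.exp (Complex.I * ((x : ℂ) - y)) = 1 := by
    have := Complex.norm_mul_exp_arg_mul_I (Complex.exp (Complex.I * ((x : ℂ) - y)))
    rw [h0] at this
    have hn : ‖Complex.exp (Complex.I * ((x : ℂ) - y))‖ = 1 := by
      rw [← Complex.ofReal_sub, mul_comm, Complex.norm_exp_ofReal_mul_I]
    rw [← this, hn]; simp
  have h2 : Real.cos (x - y) = 1 := by
    have := congrArg Complex.re h1
    rwa [← Complex.ofReal_sub, mul_comm, Complex.exp_ofReal_mul_I_re, Complex.one_re] at this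
  rw [Real.cos_eq_one_iff_of_lt_of_lt (by linarith [hx.1, hy.2]) (by linarith [hx.2, hy.1])] at h2
  exact h (by linarith)

/-! ### Least squares and duality -/

/-- By Pythagoras, minimizing means hitting the orthogonal projection of `b` onto the range, which
has exactly one preimage. -/
theorem existsUnique_isMinOn_norm_sub {V E : Type*} [AddCommGroup V] [Module ℂ V]
    [FiniteDimensional ℂ V] [NormedAddCommGroup E] [InnerProductSpace ℂ E] (T : V →ₗ[ℂ] E)
    (hT : Function.Injective T) (b : E) :
    ∃! a : V, IsMinOn (fun a' => ‖T a' - b‖) Set.univ a := by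
  set U := LinearMap.range T
  have hpy : ∀ a, ‖T a - b‖ ^ 2 = ‖T a - U.starProjection b‖ ^ 2 + ‖U.starProjection b - b‖ ^ 2 := by
    intro a
    have h := norm_add_sq_eq_norm_sq_add_norm_sq_of_inner_eq_zero
      (T a - U.starProjection b) (U.starProjection b - b) (𝕜 := ℂ) ?_
    · simpa [sq] using h
    · have hmem : T a - U.starProjection b ∈ U :=
        U.sub_mem (LinearMap.mem_range_self T a) (U.starProjection_apply_mem b)
      rw [← neg_sub b, inner_neg_right,
        Submodule.inner_right_of_mem_orthogonal hmem (U.sub_starProjection_mem_orthogonal b),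
        neg_zero]
  obtain ⟨a, ha⟩ : ∃ a, T a = U.starProjection b := U.starProjection_apply_mem b
  refine ⟨a, ?_, ?_⟩
  · intro a' _
    have h1 := hpy a'
    have h2 := hpy a
    rw [ha, sub_self, norm_zero] at h2
    refine le_of_sq_le_sq ?_ (norm_nonneg _)
    simp only
    rw [h1, ha]
    nlinarith [sq_nonneg ‖T a' - U.starProjection b‖]
  · intro a' ha'
    have h1 := hpy a'
    have h3 : ‖T a' - b‖ ≤ ‖T a - b‖ := ha' (Set.mem_univ a)
    have h4 := pow_le_pow_left₀ (norm_nonneg _) h3 2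
    rw [h1, ha] at h4
    have h5 : ‖T a' - U.starProjection b‖ ^ 2 ≤ 0 := by linarith
    have h6 : T a' - U.starProjection b = 0 := by
      rw [← norm_eq_zero]; exact pow_eq_zero_iff two_ne_zero |>.1 (le_antisymm h5 (sq_nonneg _))
    exact hT (by rw [ha]; exact sub_eq_zero.1 h6)

theorem norm_toLp_sq_le_card_mul {n : ℕ} (e : Fin n → ℂ) :
    ‖WithLp.toLp 2 e‖ ^ 2 ≤ n * ‖e‖ ^ 2 := by
  rw [EuclideanSpace.norm_sq_eq]
  have := Finset.sum_le_card_nsmul (Finset.univ : Finset (Fin n)) (fun i => ‖e i‖ ^ 2) (‖e‖ ^ 2)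
    (fun i _ => by gcongr; exact norm_le_pi_norm e i)
  simpa using this

theorem vandermondeMatrix_apply_eq {N s : ℕ} (x : Fin s → ℝ) (k : Fin (N + 1)) (l : Fin s) :
    vandermondeMatrix N x k l = circlePoint (x l) ^ (k : ℕ) := by
  rw [vandermondeMatrix, Matrix.of_apply, circlePoint, ← Complex.exp_nat_mul]
  congr 1; ring

/-- A polynomial that is one at a node and zero at the others bounds the coefficient at that
node. -/
theorem norm_sq_apply_le_of_dual {N s : ℕ} (x : Fin s → ℝ) (l : Fin s) (P : ℂ[X])
    (hP : P.natDegree ≤ N) (hl : P.eval (circlePoint (x l)) = 1)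
    (h0 : ∀ k, k ≠ l → P.eval (circlePoint (x k)) = 0) (d : Fin s → ℂ) :
    ‖d l‖ ^ 2 ≤ (∑ i ∈ P.support, ‖P.coeff i‖ ^ 2) *
      ‖WithLp.toLp 2 ((vandermondeMatrix N x).mulVec d)‖ ^ 2 := by
  have heval : ∀ z, P.eval z = ∑ n : Fin (N + 1), P.coeff n * z ^ (n : ℕ) := by
    intro z
    rw [eval_eq_sum_range' (Nat.lt_succ_of_le hP), Finset.sum_range]
  have hd : d l = ∑ n : Fin (N + 1), P.coeff n * (vandermondeMatrix N x).mulVec d n := by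
    calc d l = ∑ k, P.eval (circlePoint (x k)) * d k := by
          rw [Finset.sum_eq_single l]
          · rw [hl, one_mul]
          · intro k _ hk; rw [h0 k hk, zero_mul]
          · simp
      _ = _ := by
          simp only [heval, Matrix.mulVec, dotProduct, Finset.sum_mul, Finset.mul_sum,
            vandermondeMatrix_apply_eq]
          rw [Finset.sum_comm]
          simp only [mul_assoc]
  have hsum : ∑ i ∈ P.support, ‖P.coeff i‖ ^ 2 = ∑ n : Fin (N + 1), ‖P.coeff n‖ ^ 2 := by
    rw [← Finset.sum_range (fun n => ‖P.coeff n‖ ^ 2)]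
    refine Finset.sum_subset (fun i hi => ?_) (fun i _ hi => ?_)
    · have := le_natDegree_of_mem_supp i hi
      simp only [Finset.mem_range]; omega
    · rw [notMem_support_iff.1 hi]; simp
  rw [hsum, EuclideanSpace.norm_sq_eq]
  calc ‖d l‖ ^ 2 ≤ (∑ n : Fin (N + 1), ‖P.coeff n‖ * ‖(vandermondeMatrix N x).mulVec d n‖) ^ 2 := by
        gcongr
        rw [hd]
        refine (norm_sum_le _ _).trans (le_of_eq ?_)
        simp
    _ ≤ _ := Finset.sum_mul_sq_le_sq_mul_sq _ _ _

/-! ### The dual polynomial -/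

/-- The dual polynomial of a node `y` in a cluster `X`, where `Y` is the set of the nodes outside
the cluster. -/
theorem exists_dual_polynomial {h τ θ : ℝ} {m s N : ℕ} {X Y : Finset ℝ}
    (hX : IsUniformCluster h τ m X) {y : ℝ} (hy : y ∈ X) (hθ : 0 < θ)
    (hY : ∀ z ∈ Y, θ ≤ wrapDist y z) (hs : m + Y.card = s) (hN : s < N)
    (hNθ : 16 * Real.pi * ((s : ℝ) + 1) ^ 2 / θ ≤ N) (hNh : 2 ≤ m → N * h ≤ 1) :
    ∃ D : ℕ, N ≤ 4 * m * D ∧ ∃ P : ℂ[X], P.natDegree ≤ N ∧ P.eval (circlePoint y) = 1 ∧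
      (∀ z ∈ X, z ≠ y → P.eval (circlePoint z) = 0) ∧ (∀ z ∈ Y, P.eval (circlePoint z) = 0) ∧
      (∑ i ∈ P.support, ‖P.coeff i‖ ^ 2) * D ≤
        (2 * |Real.pi / (D * (τ * h))| ^ (m - 1)) ^ 2 := by
  have hπ := Real.pi_pos
  have hm : 0 < m := hX.card_eq ▸ Finset.card_pos.2 ⟨y, hy⟩
  have hNr : (0 : ℝ) < N := by exact_mod_cast (by omega : 0 < N)
  -- Half of `N / m`, rounded up so that `D ≥ 1`. The geometric sum and near factors use about `N /
  -- 2` of the degree, the far factors at most `N / 4`.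
  set D := (N / m + 1) / 2 with hD
  set E := N / (8 * s)
  have hq : 1 ≤ N / m := (Nat.one_le_div_iff hm).2 (by omega)
  have hD1 : 1 ≤ D := by omega
  have hqm : m * (N / m) ≤ N := Nat.mul_div_le N m
  have hDm : 2 * (m * D) ≤ N + m := by
    have : 2 * D ≤ N / m + 1 := by omega
    nlinarith
  have hND : N ≤ 4 * m * D := by
    have h1 : N < m * (N / m + 1) := Nat.lt_mul_div_succ N hm
    have h2 : N / m + 1 ≤ 4 * D := by omega
    nlinarith
  have hDN : D ≤ N := by
    have : N / m ≤ N := Nat.div_le_self _ _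
    omega
  have hEs : 8 * s * E ≤ N := Nat.mul_div_le N _
  have hNs : N < 8 * s * (E + 1) := Nat.lt_mul_div_succ N (by omega)
  have hDr : (0 : ℝ) < D := by exact_mod_cast hD1
  set z₀ := circlePoint y
  have hn0 : ‖z₀‖ = 1 := norm_circlePoint y
  -- The absolute value serves singleton clusters, where the sign of `h` is unconstrained and the
  -- product is empty.
  obtain ⟨Q₁, d1, e1, r1, b1⟩ := exists_prod_factor (X.erase y) circlePoint z₀ D
    |Real.pi / (D * (τ * h))| (by
      intro t ht
      obtain ⟨hty, htX⟩ := Finset.mem_erase.1 ht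
      have hm2 : 2 ≤ m := by
        rw [← hX.card_eq]
        exact Finset.one_lt_card.2 ⟨t, htX, y, hy, hty⟩
      have hpos := wrapDist_pos (hX.subset_Ioc y hy) (hX.subset_Ioc t htX) hty.symm
      have hle := hX.dist_le y hy t htX hty.symm
      have hge := hX.le_dist y hy t htX hty.symm
      have hh : 0 < h := hpos.trans_le hle
      have hτ := hX.tau_pos
      have hDw : D * wrapDist y t ≤ Real.pi := by
        have : (D : ℝ) * wrapDist y t ≤ N * h := by gcongr
        linarith [hNh hm2, Real.pi_gt_three]
      have hlow := norm_circlePoint_inv_mul_pow_sub_one_ge y t D hDw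
      refine exists_near_factor (norm_circlePoint t) D ?_ ?_
      · rw [← norm_pos_iff]
        exact lt_of_lt_of_le (by positivity) hlow
      · rw [abs_of_pos (by positivity)]
        calc (2 : ℝ) = Real.pi / (D * (τ * h)) * (2 / Real.pi * (D * (τ * h))) := by
              field_simp
          _ ≤ Real.pi / (D * (τ * h)) * (2 / Real.pi * (D * wrapDist y t)) := by gcongr
          _ ≤ _ := by gcongr)
  have hsr : (1 : ℝ) ≤ s := by exact_mod_cast (by omega : 1 ≤ s)
  set δ : ℝ := 1 / (2 * s) with hδ
  have hδ1 : δ ≤ 1 / 2 := by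
    rw [hδ, div_le_div_iff₀ (by positivity) (by norm_num)]; linarith
  have hNθ' : 16 * Real.pi * ((s : ℝ) + 1) ^ 2 ≤ N * θ := (div_le_iff₀ hθ).1 hNθ
  obtain ⟨Q₂, d2, e2, r2, b2⟩ := exists_prod_factor Y circlePoint z₀ (2 * E) (1 - δ)⁻¹ (by
      intro t ht
      have hlow := norm_circlePoint_inv_mul_pow_sub_one_ge y t 1
        (by simpa using wrapDist_le_pi y t)
      simp only [Nat.cast_one, one_mul, pow_one] at hlow
      have hlow' : 2 / Real.pi * θ ≤ ‖(circlePoint t)⁻¹ * z₀ - 1‖ :=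
        le_trans (by gcongr; exact hY t ht) hlow
      have hp : 0 < ‖(circlePoint t)⁻¹ * z₀ - 1‖ := lt_of_lt_of_le (by positivity) hlow'
      refine exists_far_factor hn0 (norm_circlePoint t) E (by linarith) ?_ (norm_pos_iff.1 hp)
      have hE1 : (N : ℝ) ≤ 8 * s * (E + 1) := by exact_mod_cast hNs.le
      -- The chord is at least `2 θ / π`, and `N < 8 s (E + 1)` with `N θ ≥ 16 π (s + 1)²` gives `(E
      -- + 1) θ ≥ 2 π s`.
      have h1 : 2 / ((E + 1) * ‖(circlePoint t)⁻¹ * z₀ - 1‖) ≤ δ := by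
        rw [hδ, div_le_div_iff₀ (by positivity) (by positivity)]
        have h2 : (E + 1) * (2 / Real.pi * θ) ≤ (E + 1) * ‖(circlePoint t)⁻¹ * z₀ - 1‖ := by
          gcongr
        have h3 : 4 * s ≤ (E + 1) * (2 / Real.pi * θ) := by
          have h4 : 16 * Real.pi * ((s : ℝ) + 1) ^ 2 ≤ 8 * s * (E + 1) * θ :=
            hNθ'.trans (by gcongr)
          have h5 : 8 * s * (2 * Real.pi * s) ≤ 8 * s * ((E + 1) * θ) := by
            nlinarith [mul_pos hπ (lt_of_lt_of_le one_pos hsr)]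
          have h6 : 2 * Real.pi * s ≤ (E + 1) * θ := le_of_mul_le_mul_left h5 (by positivity)
          calc (4 : ℝ) * s = 2 / Real.pi * (2 * Real.pi * s) := by field_simp; ring
            _ ≤ 2 / Real.pi * ((E + 1) * θ) := by gcongr
            _ = _ := by ring
        linarith
      have h0 : 0 ≤ 2 / ((E + 1) * ‖(circlePoint t)⁻¹ * z₀ - 1‖) := by positivity
      nlinarith)
  have hz0ne : z₀ ≠ 0 := by rw [← norm_pos_iff, hn0]; exact one_pos
  have hu : ‖z₀⁻¹‖ = 1 := by rw [norm_inv, hn0, inv_one]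
  have hcard : (X.erase y).card = m - 1 := by rw [Finset.card_erase_of_mem hy, hX.card_eq]
  rw [hcard] at d1 b1
  set K := |Real.pi / (D * (τ * h))|
  have hK : 0 ≤ K := abs_nonneg _
  have hfar : ((1 - δ)⁻¹) ^ Y.card ≤ 2 := by
    -- Bernoulli: at most `s` factors with `δ = 1 / (2 s)` leave a product of at least `1 / 2`.
    have hb := one_add_mul_le_pow (a := -δ) (by linarith) Y.card
    have hYs : (Y.card : ℝ) ≤ s := by exact_mod_cast (by omega : Y.card ≤ s)
    have h1 : (Y.card : ℝ) * δ ≤ 1 / 2 := by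
      rw [hδ, mul_one_div, div_le_div_iff₀ (by positivity) (by norm_num)]; linarith
    have h2 : (1 : ℝ) / 2 ≤ (1 - δ) ^ Y.card := by
      rw [sub_eq_add_neg]; linarith
    rw [inv_pow]
    exact inv_le_of_inv_le₀ (by norm_num) (by linarith)
  refine ⟨D, hND, (C (D : ℂ)⁻¹ * geomPoly z₀⁻¹ D) * (Q₁ * Q₂), ?_, ?_, ?_, ?_, ?_⟩
  · refine (natDegree_mul_le).trans ((add_le_add ((natDegree_C_mul_le _ _).trans
      (natDegree_geomPoly_le _ _)) ((natDegree_mul_le).trans (add_le_add d1 d2))).trans ?_)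
    obtain ⟨m', rfl⟩ : ∃ m', m = m' + 1 := ⟨m - 1, by omega⟩
    rw [Nat.add_sub_cancel]
    -- The rounding in `D` costs up to `m / 2` in degree. Without far nodes `m = s < N` absorbs it;
    -- otherwise `θ ≤ π` forces `2 s ≤ N`.
    rcases Y.eq_empty_or_nonempty with hYe | ⟨t, ht⟩
    · rw [hYe, Finset.card_empty]
      nlinarith [Nat.sub_add_cancel hD1]
    · have hθπ : θ ≤ Real.pi := (hY t ht).trans (wrapDist_le_pi y t)
      have h2s : 2 * s ≤ N := by
        have h1 : Real.pi * (16 * ((s : ℝ) + 1) ^ 2) ≤ Real.pi * N := by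
          calc _ = 16 * Real.pi * ((s : ℝ) + 1) ^ 2 := by ring
            _ ≤ N * θ := hNθ'
            _ ≤ N * Real.pi := by gcongr
            _ = _ := by ring
        have h2 := le_of_mul_le_mul_left h1 hπ
        have h3 : (2 : ℝ) * s ≤ N := by nlinarith
        exact_mod_cast h3
      have hYE : Y.card * E ≤ s * E := Nat.mul_le_mul_right _ (by omega)
      nlinarith [Nat.sub_add_cancel hD1]
  · rw [eval_mul, eval_mul, eval_mul, e1, e2, eval_C, eval_geomPoly, inv_mul_cancel₀ hz0ne]
    have : (D : ℂ) ≠ 0 := by exact_mod_cast hDr.ne'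
    simp [this]
  · intro z hz hzy
    rw [eval_mul, eval_mul (p := Q₁), r1 z (Finset.mem_erase.2 ⟨hzy, hz⟩)]; simp
  · intro z hz
    rw [eval_mul, eval_mul (p := Q₁), r2 z hz]; simp
  · have hB : ∀ z : ℂ, ‖z‖ = 1 → ‖(C (D : ℂ)⁻¹ * (Q₁ * Q₂)).eval z‖ ≤
        (D : ℝ)⁻¹ * (2 * K ^ (m - 1)) := by
      intro z hz
      rw [eval_mul, eval_mul, eval_C, norm_mul, norm_mul, norm_inv, Complex.norm_natCast,
        mul_comm 2]
      have h0 : 0 ≤ ‖Q₂.eval z‖ := norm_nonneg _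
      gcongr
      · exact b1 z hz
      · exact (b2 z hz).trans hfar
    have hmul := sum_sq_norm_coeff_mul_le (geomPoly z₀⁻¹ D) _ hB
    rw [sum_sq_norm_coeff_geomPoly hu] at hmul
    rw [show (C (D : ℂ)⁻¹ * geomPoly z₀⁻¹ D) * (Q₁ * Q₂) =
      geomPoly z₀⁻¹ D * (C (D : ℂ)⁻¹ * (Q₁ * Q₂)) by ring]
    calc _ ≤ (((D : ℝ)⁻¹ * (2 * K ^ (m - 1))) ^ 2 * D) * D := by gcongr
      _ = (2 * K ^ (m - 1)) ^ 2 := by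
          generalize K ^ (m - 1) = r
          field_simp

/-! ### Clustered configurations and the error bound -/

/-- The dual polynomial turns into a bound for one coefficient of a Vandermonde combination. -/
theorem norm_apply_le_norm_vandermonde {M s N : ℕ} {h τ : Fin M → ℝ} {m : Fin M → ℕ} {θ : ℝ}
    {x : Fin s → ℝ} {c : Fin M → Finset ℝ} (hc : IsClusteredConfiguration h τ m θ x c)
    (hN : s < N) (hNθ : 16 * Real.pi * ((s : ℝ) + 1) ^ 2 / θ ≤ N)
    {j : Fin M} (hNh : N * h j ≤ 1) {l : Fin s} (hl : x l ∈ c j) :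
    ∃ D : ℕ, N ≤ 4 * m j * D ∧ ∀ d : Fin s → ℂ,
      ‖d l‖ ^ 2 * D ≤ (2 * |Real.pi / (D * (τ j * h j))| ^ (m j - 1)) ^ 2 *
        ‖WithLp.toLp 2 ((vandermondeMatrix N x).mulVec d)‖ ^ 2 := by
  have hcX : c j ⊆ Finset.univ.image x := by
    intro y hy
    have : y ∈ Set.range x := hc.cover ▸ Set.mem_iUnion.2 ⟨j, hy⟩
    simpa using this
  have hcard : m j + (Finset.univ.image x \ c j).card = s := by
    have h1 := Finset.card_sdiff_add_card_eq_card hcX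
    rw [Finset.card_image_of_injective _ hc.injective, Finset.card_univ, Fintype.card_fin,
      (hc.cluster j).card_eq] at h1
    omega
  obtain ⟨D, hD, P, hdeg, hone, hX, hY, hP⟩ := exists_dual_polynomial (hc.cluster j) hl
    hc.theta_pos (Y := Finset.univ.image x \ c j) (by
      intro z hz
      obtain ⟨h1, h2⟩ := Finset.mem_sdiff.1 hz
      exact hc.separated j _ hl z (by simpa using h1) h2) hcard hN hNθ (fun _ => hNh)
  refine ⟨D, hD, fun d => ?_⟩
  have hd := norm_sq_apply_le_of_dual x l P hdeg hone (fun k hk => ?_) d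
  · calc _ ≤ ((∑ i ∈ P.support, ‖P.coeff i‖ ^ 2) *
          ‖WithLp.toLp 2 ((vandermondeMatrix N x).mulVec d)‖ ^ 2) * D := by gcongr
      _ = ((∑ i ∈ P.support, ‖P.coeff i‖ ^ 2) * D) *
          ‖WithLp.toLp 2 ((vandermondeMatrix N x).mulVec d)‖ ^ 2 := by ring
      _ ≤ _ := by gcongr
  · have hne : x k ≠ x l := fun h => hk (hc.injective h)
    by_cases hkc : x k ∈ c j
    · exact hX _ hkc hne
    · exact hY _ (Finset.mem_sdiff.2 ⟨by simp, hkc⟩)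

theorem IsClusteredConfiguration.card_le_sum {M s : ℕ} {h τ : Fin M → ℝ} {m : Fin M → ℕ} {θ : ℝ}
    {x : Fin s → ℝ} {c : Fin M → Finset ℝ} (hc : IsClusteredConfiguration h τ m θ x c) :
    s ≤ ∑ j, m j := by
  have hsub : Finset.univ.image x ⊆ Finset.univ.biUnion c := by
    intro y hy
    have : y ∈ Set.range x := by simpa using hy
    rw [← hc.cover] at this
    simpa using this
  have h1 := (Finset.card_le_card hsub).trans Finset.card_biUnion_le
  rw [Finset.card_image_of_injective _ hc.injective, Finset.card_univ, Fintype.card_fin] at h1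
  exact h1.trans (Finset.sum_le_sum fun j _ => (hc.cluster j).card_eq.le)

theorem IsClusteredConfiguration.exists_mem {M s : ℕ} {h τ : Fin M → ℝ} {m : Fin M → ℕ} {θ : ℝ}
    {x : Fin s → ℝ} {c : Fin M → Finset ℝ} (hc : IsClusteredConfiguration h τ m θ x c)
    (l : Fin s) : ∃ j, x l ∈ c j := by
  have : x l ∈ ⋃ j, (c j : Set ℝ) := hc.cover ▸ Set.mem_range_self l
  simpa using this

theorem IsClusteredConfiguration.pos_of_two_le {M s : ℕ} {h τ : Fin M → ℝ} {m : Fin M → ℕ}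
    {θ : ℝ} {x : Fin s → ℝ} {c : Fin M → Finset ℝ}
    (hc : IsClusteredConfiguration h τ m θ x c) {j : Fin M} (hm : 2 ≤ m j) : 0 < h j := by
  have hX := hc.cluster j
  obtain ⟨y, hy, z, hz, hyz⟩ := Finset.one_lt_card.1 (hX.card_eq.symm ▸ hm : 1 < (c j).card)
  exact (wrapDist_pos (hX.subset_Ioc y hy) (hX.subset_Ioc z hz) hyz).trans_le
    (hX.dist_le y hy z hz hyz)

theorem theorem2p5 :
    ∃ Cub : ℕ → ℝ → ℝ, (∀ (m : ℕ) (τ : ℝ), 0 < Cub m τ) ∧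
      ∀ (M : ℕ) (m : Fin M → ℕ), ∃ C₁ C₂ : ℝ, 0 < C₁ ∧ 0 < C₂ ∧
        ∀ (s : ℕ) (h τ : Fin M → ℝ) (θ : ℝ) (x : Fin s → ℝ) (c : Fin M → Finset ℝ),
          IsClusteredConfiguration h τ m θ x c →
          ∀ N : ℕ, s < N → C₁ / θ ≤ (N : ℝ) → (N : ℝ) * (⨆ j, h j) ≤ C₂ →
          ∀ (a₀ : Fin s → ℂ) (b₀ b : Fin (N + 1) → ℂ),
            b₀ = (vandermondeMatrix N x).mulVec a₀ →
            (∃! a : Fin s → ℂ, IsLeastSquaresSolution x b a) ∧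
            ∀ a : Fin s → ℂ, IsLeastSquaresSolution x b a →
              ∀ (j : Fin M), ∀ l ∈ clusterIndexSet x c j,
                ‖(a - a₀) l‖ ≤
                  Cub (m j) (τ j) * (s : ℝ) * (1 / ((N : ℝ) * h j)) ^ (m j - 1) * ‖b - b₀‖ := by
  have hπ := Real.pi_pos
  -- `|τ|` and the `+ 1` make the constant positive for every real `τ`; `12 (m + 1)` dominates the
  -- `√(128 m)` found below.
  refine ⟨fun m τ => 12 * (m + 1) * (4 * m * Real.pi / |τ| + 1) ^ (m - 1),
    fun m τ => by positivity, fun M m =>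
    ⟨16 * Real.pi * ((∑ j, m j : ℕ) + 1) ^ 2, 1, by positivity, one_pos, ?_⟩⟩
  intro s h τ θ x c hc N hsN hNθ hNh a₀ b₀ b hb
  have hθ := hc.theta_pos
  have hNr : (0 : ℝ) < N := by exact_mod_cast (by omega : 0 < N)
  have hNθ' : 16 * Real.pi * ((s : ℝ) + 1) ^ 2 / θ ≤ N := by
    refine le_trans ?_ hNθ
    have : (s : ℝ) ≤ (∑ j, m j : ℕ) := by exact_mod_cast hc.card_le_sum
    gcongr
  have hNh' : ∀ j, N * h j ≤ 1 := fun j => le_trans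
    (mul_le_mul_of_nonneg_left (le_ciSup (Set.finite_range h).bddAbove j) hNr.le) hNh
  have hDpos : ∀ {D k : ℕ}, N ≤ 4 * k * D → 0 < D := by
    intro D k hD
    rcases Nat.eq_zero_or_pos D with rfl | h
    · omega
    · exact h
  set T : (Fin s → ℂ) →ₗ[ℂ] EuclideanSpace ℂ (Fin (N + 1)) :=
    (WithLp.linearEquiv 2 ℂ (Fin (N + 1) → ℂ)).symm.toLinearMap ∘ₗ (vandermondeMatrix N x).mulVecLin
  have hTa : ∀ a, T a = WithLp.toLp 2 ((vandermondeMatrix N x).mulVec a) := fun a => rfl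
  constructor
  · refine existsUnique_isMinOn_norm_sub T ?_ (WithLp.toLp 2 b)
    rw [← LinearMap.ker_eq_bot, LinearMap.ker_eq_bot']
    intro d hd
    funext l
    obtain ⟨j, hj⟩ := hc.exists_mem l
    obtain ⟨D, hD, H⟩ := norm_apply_le_norm_vandermonde hc hsN hNθ' (hNh' j) hj
    have h1 := H d
    have hD0 : (0 : ℝ) < D := by exact_mod_cast hDpos hD
    rw [← hTa, hd, norm_zero, zero_pow two_ne_zero, mul_zero] at h1
    have h2 : ‖d l‖ ^ 2 ≤ 0 := nonpos_of_mul_nonpos_left h1 hD0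
    exact norm_eq_zero.1 (pow_eq_zero_iff two_ne_zero |>.1 (le_antisymm h2 (sq_nonneg _)))
  · intro a ha j l hl
    obtain ⟨D, hD, H⟩ := norm_apply_le_norm_vandermonde hc hsN hNθ' (hNh' j) hl
    have hD0 : (0 : ℝ) < D := by exact_mod_cast hDpos hD
    have hDr : (N : ℝ) ≤ 4 * m j * D := by exact_mod_cast hD
    have hVd : ‖T (a - a₀)‖ ≤ 2 * ‖WithLp.toLp 2 (b - b₀)‖ := by
      have h1 : ‖T a - WithLp.toLp 2 b‖ ≤ ‖T a₀ - WithLp.toLp 2 b‖ := ha (Set.mem_univ a₀)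
      have h2 : T a₀ - WithLp.toLp 2 b = -WithLp.toLp 2 (b - b₀) := by
        rw [hTa, ← hb, ← WithLp.toLp_sub, ← WithLp.toLp_neg, neg_sub]
      have h3 : T (a - a₀) = (T a - WithLp.toLp 2 b) - (T a₀ - WithLp.toLp 2 b) := by
        rw [map_sub]; abel
      have h4 := norm_sub_le (T a - WithLp.toLp 2 b) (T a₀ - WithLp.toLp 2 b)
      rw [h2, norm_neg] at h1
      rw [h3]
      rw [h2, norm_neg] at h4
      rw [h2]
      linarith
    have hcardle := norm_toLp_sq_le_card_mul (b - b₀)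
    set K := |Real.pi / (D * (τ j * h j))| with hK
    set e := ‖b - b₀‖
    have he : 0 ≤ e := norm_nonneg _
    have hs1 : (1 : ℝ) ≤ s := by exact_mod_cast (Nat.succ_le_of_lt l.pos)
    have hN1 : (N : ℝ) + 1 ≤ 8 * m j * D := by
      have : (1 : ℝ) ≤ N := by exact_mod_cast (by omega : 1 ≤ N)
      linarith
    have hmain : ‖(a - a₀) l‖ ≤ 12 * (m j + 1) * K ^ (m j - 1) * e := by
      have h1 := H (a - a₀)
      rw [← hTa] at h1
      have h2 : ‖T (a - a₀)‖ ^ 2 ≤ 4 * (8 * m j * D * e ^ 2) := by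
        calc _ ≤ (2 * ‖WithLp.toLp 2 (b - b₀)‖) ^ 2 := by gcongr
          _ = 4 * ‖WithLp.toLp 2 (b - b₀)‖ ^ 2 := by ring
          _ ≤ 4 * (((N + 1 : ℕ) : ℝ) * e ^ 2) := by gcongr
          _ ≤ _ := by push_cast; gcongr
      have h3 : ‖(a - a₀) l‖ ^ 2 * D ≤ (128 * m j * (K ^ (m j - 1) * e) ^ 2) * D := by
        calc _ ≤ (2 * K ^ (m j - 1)) ^ 2 * ‖T (a - a₀)‖ ^ 2 := h1
          _ ≤ (2 * K ^ (m j - 1)) ^ 2 * (4 * (8 * m j * D * e ^ 2)) := by gcongr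
          _ = _ := by ring
      have h4 := le_of_mul_le_mul_right h3 hD0
      refine le_of_sq_le_sq ?_ (by positivity)
      refine h4.trans ?_
      calc 128 * (m j : ℝ) * (K ^ (m j - 1) * e) ^ 2 ≤
          (12 * (m j + 1)) ^ 2 * (K ^ (m j - 1) * e) ^ 2 := by
            gcongr
            nlinarith [(Nat.cast_nonneg (m j) : (0 : ℝ) ≤ m j)]
        _ = _ := by ring
    have hKle : K ^ (m j - 1) ≤
        (4 * m j * Real.pi / |τ j| + 1) ^ (m j - 1) * (1 / (N * h j)) ^ (m j - 1) := by
      rcases Nat.lt_or_ge (m j) 2 with hm | hm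
      · rw [show m j - 1 = 0 by omega]; simp
      · rw [← mul_pow]
        have hh := hc.pos_of_two_le hm
        have hτ := (hc.cluster j).tau_pos
        refine pow_le_pow_left₀ (abs_nonneg _) ?_ _
        rw [hK, abs_of_pos (by positivity), abs_of_pos hτ]
        calc Real.pi / (D * (τ j * h j)) ≤ 4 * m j * Real.pi / τ j * (1 / (N * h j)) := by
              rw [div_mul_div_comm, mul_one, div_le_div_iff₀ (by positivity) (by positivity)]
              calc Real.pi * (τ j * (N * h j)) = (Real.pi * τ j * h j) * N := by ring
                _ ≤ (Real.pi * τ j * h j) * (4 * m j * D) := by gcongr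
                _ = _ := by ring
          _ ≤ _ := by gcongr; linarith
    calc ‖(a - a₀) l‖ ≤ 12 * (m j + 1) * K ^ (m j - 1) * e := hmain
      _ ≤ 12 * (m j + 1) * ((4 * m j * Real.pi / |τ j| + 1) ^ (m j - 1) *
            (1 / (N * h j)) ^ (m j - 1)) * e := by gcongr
      -- The estimate already holds without the factor `s ≥ 1`, inserted here.
      _ ≤ (12 * (m j + 1) * ((4 * m j * Real.pi / |τ j| + 1) ^ (m j - 1) *
            (1 / (N * h j)) ^ (m j - 1)) * e) * s := by
          refine le_mul_of_one_le_right ?_ hs1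
          have : 0 ≤ K ^ (m j - 1) := by positivity
          have := this.trans hKle
          positivity
      _ = _ := by ring
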